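/- For an irrational $x\in(0,1)$ let $x=[a_1(x),a_2(x),\dots]$ be its continued fraction expansion and $s_n(x)=\sum_{j=1}^n a_j(x)$. For a non-decreasing real sequence $\varphi(n)$, $n\ge 1$, let $E_{\varphi}=\{x\in(0,1)\setminus\mathbb{Q}:\ \lim_{n\to\infty}s_n(x)/\varphi(n)=1\}$. For $1<B<\infty$ put $$P_B(s)=\lim_{n\to\infty}\frac1n\log\sum_{(a_1,\dots,a_n)\in\mathbb{N}^n}\Big(\frac{1}{B^n q_n^2}\Big)^s\in[-\infty,\infty],\qquad s_B=\inf\{s\in\mathbb{R}:\ P_B(s)\le 0\},$$ where $\mathbb{N}=\{1,2,\dots\}$ and $q_n=q_n(a_1,\dots,a_n)$ is given by $q_{-1}=0$, $q_0=1$, $q_k=a_kq_{k-1}+q_{k-2}$ for $k\ge 1$; it is known that $1/2<s_B<1$. Let $\varphi$ be a non-decreasing real sequence and $1<B<\infty$. If $\dim_H E_{\varphi}\ge s_B$, then $$\liminf_{n\to\infty}\frac{\log\varphi(n)}{n}\le\log B.$$ (Since $s_B>0$, the hypothesis makes $E_\varphi$ non-empty, so $\varphi(n)\to\infty$ and $\log\varphi(n)$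 is defined for all large $n$.) -/

import Mathlib

open Set Filter Topology

noncomputable section

namespace CFSums

/-- The Gauss map `G(x) = {1/x}`. -/
def gaussMap (x : ℝ) : ℝ := Int.fract (1 / x)

/-- The `n`-th partial quotient `a_n(x) = ⌊1 / G^{n-1}(x)⌋` (for `n ≥ 1`) of the continued fraction
expansion `x = [a_1(x), a_2(x), …]` of an irrational `x ∈ (0,1)`. -/
def partialQuotient (n : ℕ) (x : ℝ) : ℕ := ⌊1 / (gaussMap^[n - 1] x)⌋₊

/-- `s_n(x) = a_1(x) + ⋯ + a_n(x)`. -/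
def quotientSum (n : ℕ) (x : ℝ) : ℕ := ∑ j ∈ Finset.Icc 1 n, partialQuotient j x

/-- `E_φ = {x ∈ (0,1) : s_n(x) / φ(n) → 1}`. Only irrational `x` have an infinite expansion. -/
def levelSet (φ : ℕ → ℝ) : Set ℝ :=
  {x | x ∈ Ioo (0 : ℝ) 1 ∧ Irrational x ∧
    Tendsto (fun n : ℕ => (quotientSum n x : ℝ) / φ n) atTop (𝓝 1)}

/-- The denominator `q_n(a_1, …, a_n)`, defined by `q_{-1} = 0`, `q_0 = 1` and
`q_n = a_n q_{n-1} + q_{n-2}` (the tuple is indexed by `0, …, n-1`). -/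
def convDen : (n : ℕ) → (Fin n → ℕ+) → ℕ
  | 0, _ => 1
  | 1, a => a 0
  | n + 2, a => a (Fin.last (n + 1)) * convDen (n + 1) (Fin.init a)
      + convDen n (Fin.init (Fin.init a))

/-- The sum of `(1 / (B^n q_n^2))^s` over all `n`-tuples of positive integers, possibly `∞`. -/
def partitionSum (B s : ℝ) (n : ℕ) : ENNReal :=
  ∑' a : Fin n → ℕ+, ENNReal.ofReal ((1 / (B ^ n * (convDen n a : ℝ) ^ 2)) ^ s)

/-- `p ∈ [-∞, ∞]` is the value at `s` of the pressure function
`P(s) = lim (1/n) log ∑ (1 / (B^n q_n^2))^s`. -/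
def HasPressure (B s : ℝ) (p : EReal) : Prop :=
  Tendsto (fun n : ℕ => ENNReal.log (partitionSum B s n) / (n : EReal)) atTop (𝓝 p)

/-- `s_B = inf {s : P(s) ≤ 0}`. -/
def sB (B : ℝ) : ℝ := sInf {s : ℝ | ∃ p : EReal, HasPressure B s p ∧ p ≤ 0}

end CFSums

end

namespace CFSums

open MeasureTheory

/-! If the liminf exceeds `log B`, pick `D > B` with `log D` still below it. On `E_φ` the sums `s_n`
then outgrow every multiple of `n D^n`, which forces `a_{n+1} ≥ D^n` infinitely often
(`frequently_of_mem_levelSet`). Such points are covered by pieces of cylinders of diameter at most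
`1 / (D^n q_n^2)`, so exponential decay of `partitionSum D s'` gives dimension at most `s'`
(`dimH_frequently_le`).

It remains to find such an `s' < s_B`. By Hölder, `denSum` is log-convex in the exponent.
Interpolating between `s` near `s_B`, where passing from `B` to `D` gains a factor exponentially
small in `n`, and some `t` in `(1/2, s_B)`, where growth is at most exponential, keeps the decay for
a small weight `θ` independent of `s` (`exists_partitionSum_decay`). This needs only that the set
defining `s_B` is nonempty and bounded below by some `r > 1/2`; existence of the pressure is proved
only at `s = 1`. -/

/-! ### Continuant denominators -/

lemma convDen_succ_succ (n : ℕ) (a : Fin (n + 2) → ℕ+) :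
    convDen (n + 2) a = a (Fin.last (n + 1)) * convDen (n + 1) (Fin.init a)
      + convDen n (Fin.init (Fin.init a)) := rfl

lemma convDen_pos : ∀ (n : ℕ) (a : Fin n → ℕ+), 0 < convDen n a
  | 0, _ => Nat.one_pos
  | 1, a => (a 0).pos
  | n + 2, a => by
      rw [convDen_succ_succ]
      exact Nat.add_pos_right _ (convDen_pos n _)

lemma mul_convDen_le : ∀ (n : ℕ) (a : Fin (n + 1) → ℕ+),
    a (Fin.last n) * convDen n (Fin.init a) ≤ convDen (n + 1) a
  | 0, a => by simp [convDen]
  | n + 1, a => by rw [convDen_succ_succ]; omega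

lemma convDen_init_le (n : ℕ) (a : Fin (n + 1) → ℕ+) :
    convDen n (Fin.init a) ≤ convDen (n + 1) a :=
  (Nat.le_mul_of_pos_left _ (a (Fin.last n)).pos).trans (mul_convDen_le n a)

lemma convDen_le_mul : ∀ (n : ℕ) (a : Fin (n + 1) → ℕ+),
    convDen (n + 1) a ≤ (a (Fin.last n) + 1) * convDen n (Fin.init a)
  | 0, a => by simp [convDen]
  | n + 1, a => by
      rw [convDen_succ_succ]
      have := convDen_init_le n (Fin.init a)
      nlinarith

/-! ### Sums over denominators -/

/-- The sum of `q_n ^ (-2s)` over all `n`-tuples of positive integers. -/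
noncomputable def denSum (s : ℝ) (n : ℕ) : ENNReal :=
  ∑' a : Fin n → ℕ+, ENNReal.ofReal ((convDen n a : ℝ) ^ (-2 * s))

lemma partitionSum_eq {B : ℝ} (hB : 0 < B) (s : ℝ) (n : ℕ) :
    partitionSum B s n = ENNReal.ofReal (B ^ (-(s * n))) * denSum s n := by
  rw [partitionSum, denSum, ← ENNReal.tsum_mul_left]
  refine tsum_congr fun a => ?_
  have hq : (0 : ℝ) < convDen n a := by exact_mod_cast convDen_pos n a
  rw [← ENNReal.ofReal_mul (by positivity)]
  congr 1
  rw [one_div, Real.inv_rpow (by positivity), Real.mul_rpow (by positivity) (by positivity), mul_inv,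
    ← Real.rpow_natCast, ← Real.rpow_natCast, ← Real.rpow_mul hB.le, ← Real.rpow_mul hq.le,
    ← Real.rpow_neg hB.le, ← Real.rpow_neg hq.le]
  congr 2
  · ring
  · push_cast; ring

lemma tsum_fin_succ (n : ℕ) (f : (Fin (n + 1) → ℕ+) → ENNReal) :
    ∑' a, f a = ∑' b : Fin n → ℕ+, ∑' k : ℕ+, f (Fin.snoc (α := fun _ => ℕ+) b k) := by
  rw [← (Fin.snocEquiv fun _ : Fin (n + 1) => ℕ+).tsum_eq f, ENNReal.tsum_prod', ENNReal.tsum_comm]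
  rfl

lemma denSum_zero (s : ℝ) : denSum s 0 = 1 := by
  simp [denSum, convDen]

lemma denSum_succ_le {s : ℝ} (hs : 0 ≤ s) (n : ℕ) :
    denSum s (n + 1) ≤ (∑' k : ℕ+, ENNReal.ofReal ((k : ℝ) ^ (-2 * s))) * denSum s n := by
  rw [denSum, tsum_fin_succ, denSum, ← ENNReal.tsum_mul_left]
  refine ENNReal.tsum_le_tsum fun b => ?_
  rw [← ENNReal.tsum_mul_right]
  refine ENNReal.tsum_le_tsum fun k => ?_
  have hq : (0 : ℝ) < convDen n b := by exact_mod_cast convDen_pos n b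
  have hk : (0 : ℝ) < (k : ℝ) := by exact_mod_cast k.pos
  rw [← ENNReal.ofReal_mul (by positivity), ← Real.mul_rpow hk.le hq.le]
  refine ENNReal.ofReal_le_ofReal (Real.rpow_le_rpow_of_nonpos (by positivity) ?_ (by linarith))
  have := mul_convDen_le n (Fin.snoc (α := fun _ => ℕ+) b k)
  simp only [Fin.snoc_last, Fin.init_snoc] at this
  exact_mod_cast this

lemma le_denSum_succ {s : ℝ} (hs : 0 ≤ s) (n : ℕ) :
    (∑' k : ℕ+, ENNReal.ofReal (((k : ℝ) + 1) ^ (-2 * s))) * denSum s n ≤ denSum s (n + 1) := by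
  rw [denSum, denSum, tsum_fin_succ, ← ENNReal.tsum_mul_left]
  refine ENNReal.tsum_le_tsum fun b => ?_
  rw [← ENNReal.tsum_mul_right]
  refine ENNReal.tsum_le_tsum fun k => ?_
  have hq : (0 : ℝ) < convDen n b := by exact_mod_cast convDen_pos n b
  have hk : (0 : ℝ) < (k : ℝ) := by exact_mod_cast k.pos
  rw [← ENNReal.ofReal_mul (by positivity), ← Real.mul_rpow (by positivity) hq.le]
  refine ENNReal.ofReal_le_ofReal (Real.rpow_le_rpow_of_nonpos ?_ ?_ (by linarith))
  · exact_mod_cast convDen_pos _ _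
  have := convDen_le_mul n (Fin.snoc (α := fun _ => ℕ+) b k)
  simp only [Fin.snoc_last, Fin.init_snoc] at this
  exact_mod_cast this

lemma denSum_le_pow {s : ℝ} (hs : 0 ≤ s) (n : ℕ) :
    denSum s n ≤ (∑' k : ℕ+, ENNReal.ofReal ((k : ℝ) ^ (-2 * s))) ^ n := by
  induction n with
  | zero => simp [denSum_zero]
  | succ n ih =>
    rw [pow_succ']
    exact (denSum_succ_le hs n).trans (by gcongr)

lemma pow_le_denSum {s : ℝ} (hs : 0 ≤ s) (n : ℕ) :
    (∑' k : ℕ+, ENNReal.ofReal (((k : ℝ) + 1) ^ (-2 * s))) ^ n ≤ denSum s n := by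
  induction n with
  | zero => simp [denSum_zero]
  | succ n ih =>
    rw [pow_succ']
    exact le_trans (by gcongr) (le_denSum_succ hs n)

lemma tsum_rpow_ne_top {s : ℝ} (hs : 1 / 2 < s) :
    ∑' k : ℕ+, ENNReal.ofReal ((k : ℝ) ^ (-2 * s)) ≠ ⊤ := by
  have h : Summable fun k : ℕ+ => ((k : ℕ) : ℝ) ^ (-2 * s) :=
    (Real.summable_nat_rpow.2 (by linarith)).comp_injective PNat.coe_injective
  exact h.tsum_ofReal_ne_top

/-- Hölder's inequality for counting measure on words. -/
lemma denSum_convex {s t θ : ℝ} (h0 : 0 ≤ θ) (h1 : θ ≤ 1) (n : ℕ) :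
    denSum ((1 - θ) * s + θ * t) n ≤ denSum s n ^ (1 - θ) * denSum t n ^ θ := by
  let _ : MeasurableSpace (Fin n → ℕ+) := ⊤
  have h := ENNReal.lintegral_mul_norm_pow_le (μ := (Measure.count : Measure (Fin n → ℕ+)))
    (f := fun a => ENNReal.ofReal ((convDen n a : ℝ) ^ (-2 * s)))
    (g := fun a => ENNReal.ofReal ((convDen n a : ℝ) ^ (-2 * t)))
    measurable_from_top.aemeasurable measurable_from_top.aemeasurable
    (p := 1 - θ) (q := θ) (by linarith) h0 (by ring)
  rw [lintegral_count, lintegral_count, lintegral_count] at h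
  refine le_trans (le_of_eq (tsum_congr fun a => ?_)) h
  have hq : (0 : ℝ) < convDen n a := by exact_mod_cast convDen_pos n a
  rw [ENNReal.ofReal_rpow_of_pos (by positivity), ENNReal.ofReal_rpow_of_pos (by positivity),
    ← ENNReal.ofReal_mul (by positivity), ← Real.rpow_mul hq.le, ← Real.rpow_mul hq.le,
    ← Real.rpow_add hq]
  congr 2
  ring

/-- With `q = q_n`, `r = q_{n-1}`, the lengths of the child cylinders add up to that of the parent.
-/
lemma tsum_telescope {q r : ℝ} (hq : 0 < q) (hr : 0 ≤ r) :
    ∑' k : ℕ+, ENNReal.ofReal (1 / ((k * q + r) * (k * q + r + q))) =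
      ENNReal.ofReal (1 / (q * (q + r))) := by
  have key : ∀ k : ℕ, 1 / (((k + 1 : ℕ) * q + r) * ((k + 1 : ℕ) * q + r + q)) =
      1 / (q * ((k + 1 : ℕ) * q + r)) - 1 / (q * ((k + 1 + 1 : ℕ) * q + r)) := by
    intro k
    push_cast
    field_simp
    ring
  have hs : HasSum (fun k : ℕ => 1 / (((k + 1 : ℕ) * q + r) * ((k + 1 : ℕ) * q + r + q)))
      (1 / (q * (q + r))) := by
    rw [hasSum_iff_tendsto_nat_of_nonneg (fun k => by positivity)]
    simp_rw [key]
    have : ∀ n : ℕ, ∑ k ∈ Finset.range n, (1 / (q * ((k + 1 : ℕ) * q + r)) -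
        1 / (q * ((k + 1 + 1 : ℕ) * q + r))) =
        1 / (q * (q + r)) - 1 / (q * ((n + 1 : ℕ) * q + r)) := by
      intro n
      rw [Finset.sum_range_sub' (fun k : ℕ => 1 / (q * ((k + 1 : ℕ) * q + r)))]
      simp
    simp_rw [this]
    have hlim : Tendsto (fun n : ℕ => 1 / (q * ((n + 1 : ℕ) * q + r))) atTop (𝓝 0) := by
      simp_rw [one_div]
      refine Tendsto.inv_tendsto_atTop (Tendsto.const_mul_atTop hq
        (tendsto_atTop_add_const_right _ _ (Tendsto.atTop_mul_const hq ?_)))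
      exact tendsto_natCast_atTop_atTop.comp (tendsto_add_atTop_nat 1)
    simpa using hlim.const_sub (1 / (q * (q + r)))
  rw [tsum_pnat_eq_tsum_succ
      (f := fun k : ℕ => ENNReal.ofReal (1 / ((k * q + r) * (k * q + r + q)))),
    ← hs.tsum_eq, ENNReal.ofReal_tsum_of_nonneg (fun k => by positivity) hs.summable]

lemma tsum_cylinder_length : ∀ n : ℕ, ∑' a : Fin (n + 1) → ℕ+, ENNReal.ofReal
    (1 / ((convDen (n + 1) a : ℝ) * (convDen (n + 1) a + convDen n (Fin.init a)))) = 1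
  | 0 => by
      rw [tsum_fin_succ]
      have := tsum_telescope one_pos le_rfl
      simpa [convDen, Fin.snoc] using this
  | n + 1 => by
      rw [tsum_fin_succ, ← tsum_cylinder_length n]
      refine tsum_congr fun b => ?_
      have hq : (0 : ℝ) < convDen (n + 1) b := by exact_mod_cast convDen_pos _ b
      rw [← tsum_telescope hq (Nat.cast_nonneg (convDen n (Fin.init b)))]
      refine tsum_congr fun k => ?_
      rw [convDen_succ_succ]
      simp

lemma rpow_neg_two_mul_one (q : ℝ) : q ^ (-2 * 1 : ℝ) = 1 / q ^ 2 := by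
  rw [mul_one, Real.rpow_neg_ofNat, one_div]
  norm_cast

lemma one_le_denSum_one (n : ℕ) : 1 ≤ denSum 1 (n + 1) := by
  rw [← tsum_cylinder_length n, denSum]
  refine ENNReal.tsum_le_tsum fun a => ENNReal.ofReal_le_ofReal ?_
  have hq : (0 : ℝ) < convDen (n + 1) a := by exact_mod_cast convDen_pos _ a
  rw [rpow_neg_two_mul_one]
  refine one_div_le_one_div_of_le (by positivity) ?_
  have : (0 : ℝ) ≤ convDen n (Fin.init a) := Nat.cast_nonneg _
  nlinarith

lemma denSum_one_le_two (n : ℕ) : denSum 1 (n + 1) ≤ 2 := by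
  rw [← mul_one 2, ← tsum_cylinder_length n, ← ENNReal.tsum_mul_left, denSum]
  refine ENNReal.tsum_le_tsum fun a => ?_
  have hq : (0 : ℝ) < convDen (n + 1) a := by exact_mod_cast convDen_pos _ a
  have h : (convDen n (Fin.init a) : ℝ) ≤ convDen (n + 1) a := by
    exact_mod_cast convDen_init_le n a
  rw [← ENNReal.ofReal_ofNat 2, ← ENNReal.ofReal_mul (by norm_num)]
  refine ENNReal.ofReal_le_ofReal ?_
  rw [rpow_neg_two_mul_one, mul_one_div, div_le_div_iff₀ (by positivity) (by positivity)]
  nlinarith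

lemma partitionSum_antitone {B : ℝ} (hB : 1 ≤ B) (n : ℕ) :
    Antitone fun s => partitionSum B s n := by
  intro s t hst
  refine ENNReal.tsum_le_tsum fun a => ENNReal.ofReal_le_ofReal ?_
  have hq : (1 : ℝ) ≤ convDen n a := by exact_mod_cast convDen_pos n a
  refine Real.rpow_le_rpow_of_exponent_ge (by positivity) ?_ hst
  exact div_le_one_of_le₀ (one_le_mul_of_one_le_of_one_le (one_le_pow₀ hB) (one_le_pow₀ hq))
    (by positivity)

/-! ### Pressure estimates -/

lemma le_log_div {Z : ENNReal} {n : ℕ} (hn : 0 < n) {c : ℝ}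
    (h : ENNReal.ofReal (Real.exp (c * n)) ≤ Z) : (c : EReal) ≤ ENNReal.log Z / (n : EReal) := by
  have hn' : (n : ℝ) ≠ 0 := by positivity
  have := EReal.div_le_div_right_of_nonneg (c := (n : EReal)) (by positivity)
    (ENNReal.log_le_log h)
  rw [ENNReal.log_ofReal_of_pos (Real.exp_pos _), Real.log_exp] at this
  refine le_trans (le_of_eq ?_) this
  rw [show ((n : EReal)) = ((n : ℝ) : EReal) from rfl, ← EReal.coe_div, mul_div_cancel_right₀ _ hn']

lemma log_div_le {Z : ENNReal} {n : ℕ} (hn : 0 < n) {c : ℝ}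
    (h : Z ≤ ENNReal.ofReal (Real.exp (c * n))) : ENNReal.log Z / (n : EReal) ≤ (c : EReal) := by
  have hn' : (n : ℝ) ≠ 0 := by positivity
  have := EReal.div_le_div_right_of_nonneg (c := (n : EReal)) (by positivity)
    (ENNReal.log_le_log h)
  rw [ENNReal.log_ofReal_of_pos (Real.exp_pos _), Real.log_exp] at this
  refine this.trans (le_of_eq ?_)
  rw [show ((n : EReal)) = ((n : ℝ) : EReal) from rfl, ← EReal.coe_div, mul_div_cancel_right₀ _ hn']

/-- Cylinder lengths sum to 1 and are within a factor 2 of `1 / q_n^2`, so `denSum 1 n` stays in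
`[1, 2]`. For `B > 1` this puts 1 in the set defining `s_B`. -/
lemma hasPressure_one {B : ℝ} (hB : 0 < B) : HasPressure B 1 ((-Real.log B : ℝ) : EReal) := by
  have hlim : Tendsto (fun n : ℕ => ((-Real.log B + Real.log 2 / n : ℝ) : EReal)) atTop
      (𝓝 ((-Real.log B : ℝ) : EReal)) := by
    refine (continuous_coe_real_ereal.tendsto _).comp ?_
    simpa using (tendsto_const_div_atTop_nhds_zero_nat (Real.log 2)).const_add (-Real.log B)
  have hpow : ∀ n : ℕ, B ^ (-(1 * (n : ℝ))) = Real.exp (-Real.log B * n) := by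
    intro n
    rw [Real.rpow_def_of_pos hB]
    ring_nf
  refine tendsto_of_tendsto_of_tendsto_of_le_of_le' tendsto_const_nhds hlim ?_ ?_
  · filter_upwards [eventually_gt_atTop 0] with n hn
    obtain ⟨m, rfl⟩ := Nat.exists_eq_succ_of_ne_zero hn.ne'
    refine le_log_div hn ?_
    rw [partitionSum_eq hB, hpow]
    exact le_mul_of_one_le_right' (one_le_denSum_one m)
  · filter_upwards [eventually_gt_atTop 0] with n hn
    obtain ⟨m, rfl⟩ := Nat.exists_eq_succ_of_ne_zero hn.ne'
    refine log_div_le hn ?_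
    have hn' : ((m.succ : ℕ) : ℝ) ≠ 0 := by positivity
    rw [partitionSum_eq hB, hpow, add_mul, div_mul_cancel₀ _ hn', Real.exp_add,
      Real.exp_log two_pos, ENNReal.ofReal_mul (Real.exp_pos _).le, ENNReal.ofReal_ofNat]
    gcongr
    exact denSum_one_le_two m

lemma HasPressure.eventually_le {B s : ℝ} {p : EReal} (h : HasPressure B s p) (hp : p ≤ 0)
    {ε : ℝ} (hε : 0 < ε) :
    ∀ᶠ n : ℕ in atTop, partitionSum B s n ≤ ENNReal.ofReal (Real.exp (ε * n)) := by
  have hlt : p < (ε : EReal) := hp.trans_lt (by exact_mod_cast hε)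
  filter_upwards [h.eventually_lt_const hlt, eventually_gt_atTop 0] with n hn hn0
  by_contra hc
  exact (le_log_div hn0 (not_le.1 hc).le).not_gt hn

/-- The series diverges at `r = 1/2`; a finite partial sum above `M` there stays above `M` slightly
to the right, by continuity. -/
lemma exists_half_lt_tsum_gt (M : ℝ) : ∃ r : ℝ, 1 / 2 < r ∧ r < 1 ∧
    ENNReal.ofReal M ≤ ∑' k : ℕ+, ENNReal.ofReal (((k : ℝ) + 1) ^ (-2 * r)) := by
  obtain ⟨N, hN⟩ : ∃ N : ℕ, M <
      ∑ k ∈ Finset.range N, (((k + 1 : ℕ) : ℝ) + 1) ^ (-2 * (1 / 2) : ℝ) := by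
    have hns : ¬ Summable fun k : ℕ => (((k + 1 : ℕ) : ℝ) + 1) ^ (-2 * (1 / 2) : ℝ) := by
      intro h
      have h2 : Summable fun k : ℕ => ((k + 2 : ℕ) : ℝ) ^ (-2 * (1 / 2) : ℝ) := by
        refine h.congr fun k => ?_
        push_cast
        ring_nf
      rw [summable_nat_add_iff (f := fun k : ℕ => (k : ℝ) ^ (-2 * (1 / 2) : ℝ)) 2,
        Real.summable_nat_rpow] at h2
      norm_num at h2
    exact ((not_summable_iff_tendsto_nat_atTop_of_nonneg fun k => by positivity).1
      hns).eventually_gt_atTop M |>.exists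
  have hc : Continuous fun r : ℝ => ∑ k ∈ Finset.range N, (((k + 1 : ℕ) : ℝ) + 1) ^ (-2 * r) :=
    continuous_finsetSum _ fun k _ =>
      Continuous.rpow continuous_const (by fun_prop) fun _ => Or.inl (by positivity)
  have hev : ∀ᶠ r in 𝓝[>] (1 / 2 : ℝ),
      M < ∑ k ∈ Finset.range N, (((k + 1 : ℕ) : ℝ) + 1) ^ (-2 * r) :=
    (hc.continuousAt.eventually (lt_mem_nhds hN)).filter_mono nhdsWithin_le_nhds
  obtain ⟨r, hr, hr'⟩ := (hev.and (Ioo_mem_nhdsGT (by norm_num : (1 / 2 : ℝ) < 1))).exists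
  refine ⟨r, hr'.1, hr'.2, ?_⟩
  rw [tsum_pnat_eq_tsum_succ (f := fun k : ℕ => ENNReal.ofReal (((k : ℝ) + 1) ^ (-2 * r)))]
  refine le_trans ?_ (ENNReal.sum_le_tsum (Finset.range N))
  rw [← ENNReal.ofReal_sum_of_nonneg fun k _ => by positivity]
  exact ENNReal.ofReal_le_ofReal hr.le

/-- There is `r > 1/2` below which the pressure is positive. -/
lemma exists_half_lt_lowerBound {B : ℝ} (hB : 1 < B) :
    ∃ r : ℝ, 1 / 2 < r ∧ ∀ s p, HasPressure B s p → p ≤ 0 → r < s := by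
  -- The factor `B` absorbs `B ^ (-r)` since `r < 1`; the factor `e` leaves growth `e^n`, against
  -- the bound `e^(n/2)` implied by nonpositive pressure.
  obtain ⟨r, hr, hr1, hM⟩ := exists_half_lt_tsum_gt (B * Real.exp 1)
  refine ⟨r, hr, fun s p h hp => ?_⟩
  by_contra! hs
  have hB0 : 0 < B := by linarith
  obtain ⟨n, hn, hn0⟩ := ((h.eventually_le hp (ε := 1 / 2) (by norm_num)).and
    (eventually_gt_atTop 0)).exists
  have hn' : (0 : ℝ) < n := by exact_mod_cast hn0
  have h1 : ENNReal.ofReal (Real.exp (1 * n)) ≤ partitionSum B r n := by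
    rw [partitionSum_eq hB0]
    refine le_trans ?_ (mul_le_mul_right ((pow_le_pow_left₀ (by positivity) hM n).trans
      (pow_le_denSum (by linarith) n)) _)
    rw [← ENNReal.ofReal_pow (by positivity), ← ENNReal.ofReal_mul (by positivity)]
    refine ENNReal.ofReal_le_ofReal ?_
    rw [mul_pow, ← Real.exp_nat_mul, mul_comm (1 : ℝ), ← mul_assoc, mul_one (n : ℝ)]
    refine le_mul_of_one_le_left (Real.exp_pos _).le ?_
    rw [← Real.rpow_natCast, ← Real.rpow_add hB0]
    exact Real.one_le_rpow hB.le (by nlinarith)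
  have h2 := (h1.trans (partitionSum_antitone hB.le n hs)).trans hn
  rw [ENNReal.ofReal_le_ofReal_iff (Real.exp_pos _).le, Real.exp_le_exp] at h2
  linarith

lemma exists_partitionSum_decay {B D t : ℝ} (hB : 1 < B) (hD : B < D) (ht : 1 / 2 < t) :
    ∃ θ : ℝ, 0 < θ ∧ θ < 1 ∧ ∀ s p, 1 / 2 < s → HasPressure B s p → p ≤ 0 →
      ∃ c : ℝ, 0 < c ∧ ∀ᶠ n : ℕ in atTop, partitionSum D ((1 - θ) * s + θ * t) n ≤
        ENNReal.ofReal (Real.exp (-c * n)) := by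
  have hB0 : 0 < B := by linarith
  have hD0 : 0 < D := by linarith
  have hlB : 0 < Real.log B := Real.log_pos hB
  have hl : Real.log B < Real.log D := Real.log_lt_log hB0 hD
  obtain ⟨k, hk0, hk⟩ : ∃ k : ℝ, 0 < k ∧
      ∑' k : ℕ+, ENNReal.ofReal ((k : ℝ) ^ (-2 * t)) ≤ ENNReal.ofReal (Real.exp k) := by
    set K := ∑' k : ℕ+, ENNReal.ofReal ((k : ℝ) ^ (-2 * t)) with hK
    have hK0 : 0 ≤ K.toReal := ENNReal.toReal_nonneg
    refine ⟨K.toReal + 1, by linarith, ?_⟩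
    refine (ENNReal.le_ofReal_iff_toReal_le (hK ▸ tsum_rpow_ne_top ht) (Real.exp_pos _).le).2 ?_
    linarith [Real.add_one_le_exp (K.toReal + 1)]
  set l := Real.log D - Real.log B with hldef
  have hl0 : 0 < l := by linarith
  obtain ⟨θ, hθ0, hθ1, hθ⟩ : ∃ θ : ℝ, 0 < θ ∧ θ < 1 ∧ θ * k < (1 - θ) * (l / 4) := by
    -- As `s > 1/2`, replacing `B` by `D` gains over `l / 2` in the exponent at `s`. The pressure
    -- error costs `l / 4`, and `θ` is small enough that the cost `θ * k` at `t` is less than what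
    -- remains.
    refine ⟨(l / 4) / (k + l / 2), by positivity, ?_, ?_⟩
    · rw [div_lt_one (by positivity)]
      linarith
    · have h1 : (l / 4) / (k + l / 2) * (k + l / 2) = l / 4 := div_mul_cancel₀ _ (by positivity)
      have h2 : 0 < (l / 4) / (k + l / 2) * (l / 4) := by positivity
      linarith
  refine ⟨θ, hθ0, hθ1, fun s p hs h hp => ⟨(1 - θ) * (l / 4) - θ * k, by linarith, ?_⟩⟩
  filter_upwards [h.eventually_le hp (ε := l / 4) (by linarith)] with n hn
  have hn0 : (0 : ℝ) ≤ n := Nat.cast_nonneg n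
  have hs1 : denSum s n ≤ ENNReal.ofReal (Real.exp ((s * Real.log B + l / 4) * n)) := by
    have : denSum s n = ENNReal.ofReal (B ^ (s * n)) * partitionSum B s n := by
      rw [partitionSum_eq hB0, ← mul_assoc, ← ENNReal.ofReal_mul (by positivity),
        ← Real.rpow_add hB0]
      simp
    rw [this]
    refine (mul_le_mul_right hn _).trans (le_of_eq ?_)
    rw [← ENNReal.ofReal_mul (by positivity), Real.rpow_def_of_pos hB0, ← Real.exp_add]
    ring_nf
  have hs2 : denSum t n ≤ ENNReal.ofReal (Real.exp (k * n)) := by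
    refine ((denSum_le_pow (by linarith) n).trans (pow_le_pow_left₀ (by positivity) hk n)).trans
      (le_of_eq ?_)
    rw [← ENNReal.ofReal_pow (Real.exp_pos _).le, ← Real.exp_nat_mul, mul_comm]
  rw [partitionSum_eq hD0]
  refine (mul_le_mul_right ((denSum_convex hθ0.le hθ1.le n).trans
    (mul_le_mul' (ENNReal.rpow_le_rpow hs1 (by linarith)) (ENNReal.rpow_le_rpow hs2 hθ0.le)))
    _).trans ?_
  rw [ENNReal.ofReal_rpow_of_pos (Real.exp_pos _), ENNReal.ofReal_rpow_of_pos (Real.exp_pos _),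
    ← Real.exp_mul, ← Real.exp_mul, Real.rpow_def_of_pos hD0,
    ← ENNReal.ofReal_mul (Real.exp_pos _).le, ← ENNReal.ofReal_mul (Real.exp_pos _).le,
    ← Real.exp_add, ← Real.exp_add]
  refine ENNReal.ofReal_le_ofReal (Real.exp_le_exp.2 ?_)
  have h1 : 0 ≤ (1 - θ) * (s - 1 / 2) * l :=
    mul_nonneg (mul_nonneg (by linarith) (by linarith)) hl0.le
  have h2 : 0 ≤ θ * t * Real.log D := by
    have : 0 < t := by linarith
    have : 0 < Real.log D := by linarith
    positivity
  have h3 : 0 ≤ ((1 - θ) * (s - 1 / 2) * l + θ * t * Real.log D) * n :=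
    mul_nonneg (by linarith) hn0
  have h4 : Real.log B = Real.log D - l := by rw [hldef]; ring
  rw [h4]
  linear_combination h3

/-! ### Gauss map and cylinder geometry -/

/-- The irrational numbers in `(0,1)`. -/
def irrUnit : Set ℝ := {x | x ∈ Ioo (0 : ℝ) 1 ∧ Irrational x}

lemma mul_floor_add_gaussMap {x : ℝ} (hx : x ∈ irrUnit) :
    x * (⌊1 / x⌋₊ + gaussMap x) = 1 := by
  have hx0 := hx.1.1
  rw [gaussMap, natCast_floor_eq_intCast_floor (by positivity), Int.floor_add_fract,
    mul_one_div_cancel hx0.ne']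

lemma floor_one_div_pos {x : ℝ} (hx : x ∈ irrUnit) : 0 < ⌊1 / x⌋₊ :=
  Nat.floor_pos.2 ((one_le_div hx.1.1).2 hx.1.2.le)

lemma gaussMap_mem {x : ℝ} (hx : x ∈ irrUnit) : gaussMap x ∈ irrUnit := by
  have hirr : Irrational (gaussMap x) := by
    rw [gaussMap, Int.fract, one_div]
    exact hx.2.inv.sub_intCast _
  refine ⟨⟨(Int.fract_nonneg _).lt_of_ne ?_, Int.fract_lt_one _⟩, hirr⟩
  exact hirr.ne_zero.symm

lemma iterate_gaussMap_mem {x : ℝ} (hx : x ∈ irrUnit) (n : ℕ) : gaussMap^[n] x ∈ irrUnit := by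
  induction n with
  | zero => exact hx
  | succ n ih => rw [Function.iterate_succ_apply']; exact gaussMap_mem ih

lemma partialQuotient_pos {x : ℝ} (hx : x ∈ irrUnit) (n : ℕ) : 0 < partialQuotient n x :=
  floor_one_div_pos (iterate_gaussMap_mem hx _)

lemma iterate_mul_partialQuotient_add {x : ℝ} (hx : x ∈ irrUnit) (n : ℕ) :
    gaussMap^[n] x * (partialQuotient (n + 1) x + gaussMap^[n + 1] x) = 1 := by
  rw [Function.iterate_succ_apply']
  exact mul_floor_add_gaussMap (iterate_gaussMap_mem hx n)

/-- The first `n` partial quotients of `x`. -/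
noncomputable def word (n : ℕ) (x : ℝ) : Fin n → ℕ+ := fun i => (partialQuotient (i + 1) x).toPNat'

lemma init_word (n : ℕ) (x : ℝ) : Fin.init (word (n + 1) x) = word n x := rfl

lemma coe_word_last {x : ℝ} (hx : x ∈ irrUnit) (n : ℕ) :
    (word (n + 1) x (Fin.last n) : ℕ) = partialQuotient (n + 1) x := by
  simp [word, partialQuotient_pos hx]

lemma prod_iterate_mul {x : ℝ} (hx : x ∈ irrUnit) (n : ℕ) :
    (∏ i ∈ Finset.range (n + 1), gaussMap^[i] x) *
      (convDen (n + 1) (word (n + 1) x) + gaussMap^[n + 1] x * convDen n (word n x)) = 1 := by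
  induction n with
  | zero =>
    have h := iterate_mul_partialQuotient_add hx 0
    have h2 : convDen 1 (word 1 x) = partialQuotient 1 x := coe_word_last hx 0
    rw [zero_add, h2]
    simpa [convDen] using h
  | succ n ih =>
    have h := iterate_mul_partialQuotient_add hx (n + 1)
    rw [Finset.prod_range_succ, convDen_succ_succ, init_word, init_word, coe_word_last hx]
    push_cast
    linear_combination ih + (∏ i ∈ Finset.range (n + 1), gaussMap^[i] x) *
      convDen (n + 1) (word (n + 1) x) * h

lemma prod_iterate_nonneg {x : ℝ} (hx : x ∈ irrUnit) (n : ℕ) :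
    0 ≤ ∏ i ∈ Finset.range n, gaussMap^[i] x :=
  Finset.prod_nonneg fun i _ => (iterate_gaussMap_mem hx i).1.1.le

lemma prod_iterate_le {x : ℝ} (hx : x ∈ irrUnit) (n : ℕ) :
    ∏ i ∈ Finset.range n, gaussMap^[i] x ≤ 1 / convDen n (word n x) := by
  cases n with
  | zero => simp [convDen]
  | succ n =>
    have hq : (0 : ℝ) < convDen (n + 1) (word (n + 1) x) := by exact_mod_cast convDen_pos _ _
    rw [le_div_iff₀ hq, ← prod_iterate_mul hx n]
    refine mul_le_mul_of_nonneg_left ?_ (prod_iterate_nonneg hx _)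
    have := (iterate_gaussMap_mem hx (n + 1)).1.1
    exact le_add_of_nonneg_right (by positivity)

/-- On a common branch `1/u - 1/v = G u - G v`, so each step back multiplies the distance by `u *
v`. -/
lemma abs_sub_eq {x y : ℝ} (hx : x ∈ irrUnit) (hy : y ∈ irrUnit) (n : ℕ)
    (h : word n x = word n y) :
    |x - y| = |gaussMap^[n] x - gaussMap^[n] y| * (∏ i ∈ Finset.range n, gaussMap^[i] x) *
      ∏ i ∈ Finset.range n, gaussMap^[i] y := by
  induction n with
  | zero => simp
  | succ n ih =>
    have h1 : partialQuotient (n + 1) x = partialQuotient (n + 1) y := by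
      rw [← coe_word_last hx, ← coe_word_last hy, h]
    have hx1 := iterate_mul_partialQuotient_add hx n
    have hy1 := iterate_mul_partialQuotient_add hy n
    have hx0 := (iterate_gaussMap_mem hx n).1.1
    have hy0 := (iterate_gaussMap_mem hy n).1.1
    rw [h1] at hx1
    have h2 : gaussMap^[n] x - gaussMap^[n] y = -((gaussMap^[n + 1] x - gaussMap^[n + 1] y) *
        (gaussMap^[n] x * gaussMap^[n] y)) := by
      linear_combination gaussMap^[n] y * hx1 - gaussMap^[n] x * hy1
    rw [ih (congrArg Fin.init h), h2, abs_neg, abs_mul, abs_of_pos (mul_pos hx0 hy0),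
      Finset.prod_range_succ, Finset.prod_range_succ]
    ring

lemma abs_sub_le {x y δ : ℝ} (hx : x ∈ irrUnit) (hy : y ∈ irrUnit) (n : ℕ)
    (h : word n x = word n y) (hxδ : gaussMap^[n] x ≤ δ) (hyδ : gaussMap^[n] y ≤ δ) :
    |x - y| ≤ δ / (convDen n (word n x) : ℝ) ^ 2 := by
  have hx0 := (iterate_gaussMap_mem hx n).1.1
  have hy0 := (iterate_gaussMap_mem hy n).1.1
  have h1 : |gaussMap^[n] x - gaussMap^[n] y| ≤ δ := abs_sub_le_iff.2 ⟨by linarith, by linarith⟩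
  have h2 := prod_iterate_le hy n
  rw [← h] at h2
  rw [abs_sub_eq hx hy n h]
  calc _ ≤ δ * (1 / convDen n (word n x)) * (1 / convDen n (word n x)) := by
        have hδ : 0 ≤ δ := by linarith
        refine mul_le_mul (mul_le_mul h1 (prod_iterate_le hx n) (prod_iterate_nonneg hx n) hδ) h2
          (prod_iterate_nonneg hy n) (by positivity)
    _ = _ := by ring

/-! ### Covering and Hausdorff dimension -/

/-- The points of the cylinder of `a` whose next partial quotient is at least about `D ^ n`. -/
def thinCylinder (D : ℝ) (n : ℕ) (a : Fin n → ℕ+) : Set ℝ :=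
  {x | x ∈ irrUnit ∧ word n x = a ∧ gaussMap^[n] x ≤ 1 / D ^ n}

lemma ediam_thinCylinder_le (D : ℝ) (n : ℕ) (a : Fin n → ℕ+) :
    Metric.ediam (thinCylinder D n a) ≤ ENNReal.ofReal (1 / (D ^ n * (convDen n a : ℝ) ^ 2)) := by
  refine Metric.ediam_le fun x hx y hy => ?_
  rw [edist_dist, Real.dist_eq]
  refine ENNReal.ofReal_le_ofReal ?_
  have := abs_sub_le hx.1 hy.1 n (hx.2.1.trans hy.2.1.symm) hx.2.2 hy.2.2
  rwa [hx.2.1, div_div] at this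

lemma dimH_frequently_le {D s c : ℝ} (hD : 1 < D) (hs : 0 ≤ s) (hc : 0 < c)
    (h : ∀ᶠ n : ℕ in atTop, partitionSum D s n ≤ ENNReal.ofReal (Real.exp (-c * n))) :
    dimH {x | x ∈ irrUnit ∧ ∃ᶠ n : ℕ in atTop, D ^ n ≤ partialQuotient (n + 1) x} ≤
      ENNReal.ofReal s := by
  have hD0 : 0 < D := by linarith
  set S := {x | x ∈ irrUnit ∧ ∃ᶠ n : ℕ in atTop, D ^ n ≤ partialQuotient (n + 1) x}
  have hr : Tendsto (fun N : ℕ => ENNReal.ofReal ((1 / D) ^ N)) atTop (𝓝 0) := by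
    rw [← ENNReal.ofReal_zero]
    refine ENNReal.tendsto_ofReal (tendsto_pow_atTop_nhds_zero_of_lt_one (by positivity) ?_)
    rwa [div_lt_one hD0]
  have hmeas := Measure.hausdorffMeasure_le_liminf_tsum
    -- The `N`-th cover uses all words of length at least `N`; its cost is the tail of a convergent
    -- series.
    (ι := fun N : ℕ => Σ k : ℕ, (Fin (k + N) → ℕ+)) s S (l := atTop) _ hr
    (fun N i => thinCylinder D (i.1 + N) i.2)
    (Eventually.of_forall fun N i => (ediam_thinCylinder_le D _ _).trans
      (ENNReal.ofReal_le_ofReal (by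
        have hq : (1 : ℝ) ≤ convDen (i.1 + N) i.2 := by exact_mod_cast convDen_pos _ _
        rw [one_div_pow]
        refine one_div_le_one_div_of_le (by positivity) ?_
        exact (pow_le_pow_right₀ hD.le (Nat.le_add_left _ _)).trans
          (le_mul_of_one_le_right (by positivity) (one_le_pow₀ hq)))))
    (Eventually.of_forall fun N x hx => by
      obtain ⟨n, hn, hNn⟩ := (hx.2.and_eventually (eventually_ge_atTop N)).exists
      obtain ⟨k, rfl⟩ := Nat.exists_eq_add_of_le' hNn
      refine mem_iUnion.2 ⟨⟨k, word (k + N) x⟩, hx.1, rfl, ?_⟩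
      have h1 := iterate_mul_partialQuotient_add hx.1 (k + N)
      have h2 := (iterate_gaussMap_mem hx.1 (k + N)).1.1
      have h3 := (iterate_gaussMap_mem hx.1 (k + N + 1)).1.1
      rw [le_div_iff₀ (by positivity), ← h1]
      exact mul_le_mul_of_nonneg_left (by linarith) h2.le)
  have hsum : ∑' n : ℕ, ENNReal.ofReal (Real.exp (-c * n)) ≠ ⊤ := by
    have : Summable fun n : ℕ => Real.exp (-c * n) := by
      simp_rw [mul_comm (-c)]
      exact Real.summable_exp_nat_mul_iff.2 (by linarith)
    exact this.tsum_ofReal_ne_top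
  have hzero : Tendsto (fun N : ℕ => ∑' i : Σ k : ℕ, (Fin (k + N) → ℕ+),
      Metric.ediam (thinCylinder D (i.1 + N) i.2) ^ s) atTop (𝓝 0) := by
    refine tendsto_of_tendsto_of_tendsto_of_le_of_le' tendsto_const_nhds
      (ENNReal.tendsto_sum_nat_add _ hsum) (Eventually.of_forall fun _ => zero_le) ?_
    obtain ⟨M, hM⟩ := eventually_atTop.1 h
    filter_upwards [eventually_ge_atTop M] with N hN
    rw [ENNReal.tsum_sigma']
    refine ENNReal.tsum_le_tsum fun k => le_trans ?_ (hM (k + N) (by omega))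
    refine ENNReal.tsum_le_tsum fun a => ?_
    rw [← ENNReal.ofReal_rpow_of_nonneg (by positivity) hs]
    exact ENNReal.rpow_le_rpow (ediam_thinCylinder_le D _ _) hs
  rw [hzero.liminf_eq] at hmeas
  refine dimH_le_of_hausdorffMeasure_ne_top (d := s.toNNReal) ?_
  rw [Real.coe_toNNReal _ hs]
  exact ne_top_of_le_ne_top ENNReal.zero_ne_top hmeas

/-! ### From growth of sums to large partial quotients -/

lemma quotientSum_eq (n : ℕ) (x : ℝ) :
    quotientSum n x = ∑ i ∈ Finset.range n, partialQuotient (i + 1) x := by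
  rw [quotientSum, Finset.range_eq_Ico, Finset.sum_Ico_add' (fun i => partialQuotient i x) 0 n 1]
  rfl

lemma frequently_of_eventually_quotientSum {C D x : ℝ} (hD : 1 < D) (hC : D < C)
    (h : ∀ᶠ n : ℕ in atTop, C ^ n / 2 < quotientSum n x) :
    ∃ᶠ n : ℕ in atTop, D ^ n ≤ partialQuotient (n + 1) x := by
  intro hcon
  obtain ⟨N, hN⟩ := eventually_atTop.1 hcon
  have hC0 : 0 < C := by linarith
  -- The sum handles the indices below `N`; the extra 1 makes the same constant work beyond `N`.
  set K : ℝ := 1 + ∑ i ∈ Finset.range N, (partialQuotient (i + 1) x : ℝ)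
  have hK : 1 ≤ K := le_add_of_nonneg_right (Finset.sum_nonneg fun _ _ => Nat.cast_nonneg _)
  have hbound : ∀ i : ℕ, (partialQuotient (i + 1) x : ℝ) ≤ K * D ^ i := by
    intro i
    have hDi : 1 ≤ D ^ i := one_le_pow₀ hD.le
    rcases lt_or_ge i N with hi | hi
    · have := Finset.single_le_sum (f := fun i => (partialQuotient (i + 1) x : ℝ))
        (fun _ _ => Nat.cast_nonneg _) (Finset.mem_range.2 hi)
      have : (partialQuotient (i + 1) x : ℝ) ≤ K := by simp only [K]; linarith
      nlinarith
    · have := not_le.1 (hN i hi)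
      nlinarith
  have hsum : ∀ n : ℕ, (quotientSum n x : ℝ) ≤ n * (K * D ^ n) := by
    intro n
    rw [quotientSum_eq, Nat.cast_sum, ← nsmul_eq_mul, ← Finset.card_range n,
      Finset.card_range n]
    refine (Finset.sum_le_card_nsmul _ _ (K * D ^ n) fun i hi => (hbound i).trans ?_).trans
      (by rw [Finset.card_range])
    have := pow_le_pow_right₀ hD.le (Finset.mem_range.1 hi).le
    gcongr
  have hlim : Tendsto (fun n : ℕ => K * (n * (D / C) ^ n)) atTop (𝓝 (K * 0)) :=
    (tendsto_self_mul_const_pow_of_lt_one (by positivity) ((div_lt_one hC0).2 hC)).const_mul K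
  rw [mul_zero] at hlim
  obtain ⟨n, hn1, hn2⟩ := (h.and (hlim.eventually_lt_const (half_pos one_pos))).exists
  have h1 := hn1.trans_le (hsum n)
  rw [div_pow, ← mul_div_assoc, ← mul_div_assoc, div_lt_iff₀ (by positivity)] at hn2
  linarith

lemma frequently_of_mem_levelSet {φ : ℕ → ℝ} {c D x : ℝ} (hD : 1 < D) (hDc : D < Real.exp c)
    (hφ : ∀ᶠ n : ℕ in atTop, c < Real.log (φ n) / n) (hx : x ∈ levelSet φ) :
    ∃ᶠ n : ℕ in atTop, D ^ n ≤ partialQuotient (n + 1) x := by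
  refine frequently_of_eventually_quotientSum hD hDc ?_
  filter_upwards [hφ, hx.2.2.eventually_const_lt (half_lt_self one_pos), eventually_gt_atTop 0]
    with n h1 h2 h3
  have hn : (0 : ℝ) < n := by exact_mod_cast h3
  -- Excludes the conventional values of `Real.log` and division at nonpositive `φ n`.
  have hpos : 0 < φ n := by
    by_contra! hle
    have := div_nonpos_of_nonneg_of_nonpos (Nat.cast_nonneg (α := ℝ) (quotientSum n x)) hle
    linarith
  rw [lt_div_iff₀ hpos] at h2
  rw [lt_div_iff₀ hn, Real.lt_log_iff_exp_lt hpos, mul_comm, Real.exp_nat_mul] at h1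
  linarith

lemma dimH_levelSet_lt {φ : ℕ → ℝ} {B c : ℝ} (hB : 1 < B) (hc : Real.log B < c)
    (hφ : ∀ᶠ n : ℕ in atTop, c < Real.log (φ n) / n) :
    dimH (levelSet φ) < ENNReal.ofReal (sB B) := by
  have hB0 : 0 < B := by linarith
  obtain ⟨D, hBD, hDc⟩ := exists_between ((Real.log_lt_iff_lt_exp hB0).1 hc)
  obtain ⟨r, hr, hlow⟩ := exists_half_lt_lowerBound hB
  obtain ⟨t, ht, htr⟩ := exists_between hr
  obtain ⟨θ, hθ0, hθ1, hdecay⟩ := exists_partitionSum_decay hB hBD ht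
  have hne : {s : ℝ | ∃ p : EReal, HasPressure B s p ∧ p ≤ 0}.Nonempty :=
    ⟨1, _, hasPressure_one hB0, by exact_mod_cast neg_nonpos.2 (Real.log_pos hB).le⟩
  have hrB : r ≤ sB B := le_csInf hne fun s ⟨p, h, hp⟩ => (hlow s p h hp).le
  -- The infimum need not be attained. Since `θ` is fixed before `s`, an `s` this close to `s_B`
  -- gives an interpolated exponent below `s_B - θ^2 (s_B - t)`.
  have hlt : sInf {s : ℝ | ∃ p : EReal, HasPressure B s p ∧ p ≤ 0} <
      sB B + θ * (sB B - t) := lt_add_of_pos_right _ (mul_pos hθ0 (by linarith))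
  obtain ⟨s, ⟨p, h, hp⟩, hs⟩ := exists_lt_of_csInf_lt hne hlt
  have hrs := hlow s p h hp
  obtain ⟨d, hd, hev⟩ := hdecay s p (by linarith) h hp
  have hs'0 : 0 ≤ (1 - θ) * s + θ * t :=
    add_nonneg (mul_nonneg (by linarith) (by linarith)) (mul_nonneg hθ0.le (by linarith))
  have hs' : (1 - θ) * s + θ * t < sB B := by
    have h1 := mul_lt_mul_of_pos_left hs (sub_pos.2 hθ1)
    have h2 : 0 < θ * θ * (sB B - t) := by
      have : 0 < sB B - t := by linarith
      positivity
    nlinarith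
  have hD : 1 < D := hB.trans hBD
  calc dimH (levelSet φ)
      ≤ dimH {x | x ∈ irrUnit ∧ ∃ᶠ n : ℕ in atTop, D ^ n ≤ partialQuotient (n + 1) x} :=
        dimH_mono fun x hx => ⟨⟨hx.1, hx.2.1⟩, frequently_of_mem_levelSet hD hDc hφ hx⟩
    _ ≤ ENNReal.ofReal ((1 - θ) * s + θ * t) := dimH_frequently_le hD hs'0 hd hev
    _ < ENNReal.ofReal (sB B) :=
        (ENNReal.ofReal_lt_ofReal_iff (by linarith)).2 hs'

end CFSums

theorem mainTheorem5 (φ : ℕ → ℝ) (hφ : MonotoneOn φ (Set.Ici 1)) (B : ℝ) (hB : 1 < B)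
    (hdim : ENNReal.ofReal (CFSums.sB B) ≤ dimH (CFSums.levelSet φ)) :
    liminf (fun n : ℕ => ((Real.log (φ n) / n : ℝ) : EReal)) atTop ≤ ((Real.log B : ℝ) : EReal) := by
  by_contra! hlt
  obtain ⟨c, hBc, hc⟩ := EReal.lt_iff_exists_real_btwn.1 hlt
  refine (CFSums.dimH_levelSet_lt hB (EReal.coe_lt_coe_iff.1 hBc) ?_).not_ge hdim
  filter_upwards [eventually_lt_of_lt_liminf hc] with n hn
  exact EReal.coe_lt_coe_iff.1 hn
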